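/- **Theorem (Existence of minimizers).** Let $\Omega\subseteq\mathbb R^n$ be a bounded open set and $\mathcal N\subseteq\mathbb R^\ell$ a non-empty compact set. Let $j:\mathbb R^n\to[0,+\infty]$ be a measurable kernel such that 1. $j(-z)=j(z)$ for all $z\in\mathbb R^n$; 2. $\int_{\mathbb R^n}\min\{1,|z|^2\}\,j(z)\,dz<+\infty$; 3. $j\notin L^1(B_R)$ for every $R>0$, where $B_R$ is the ball of radius $R$ centred at the origin. Let $\Lambda\ge 1$, let $K:\Omega\times\Omega\to[0,+\infty]$ be measurable with $\frac1\Lambda j(x-y)\le K(x,y)$ for a.e. $x,y\in\Omega$, and let $\psi:\mathcal N\times\mathcal N\to[0,+\infty)$ be continuous with $\frac1\Lambda|p-q|^2\le\psi(p,q)\le\Lambda|p-q|^2$ for all $p,q\in\mathcal N$. Set $$L^2(\Omega;\mathcal N):=\{m\in L^2(\Omega;\mathbb R^\ell): m\in\mathcal N\text{ a.e. in }\Omega\},$$ $$\mathcal X^K(\Omega;\mathcal N):=\Big\{m\in L^2(\Omega;\mathcal N):\iint_{\Omega\times\Omega}K(x,y)\,|m(x)-m(y)|^2\,dx\,dy<+\infty\Big\}.$$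 Let $\mathcal P_\Omega:L^2(\Omega;\mathcal N)\to\mathbb R$ be bounded from below and continuous for the strong $L^2$ topology. Then the functional $$\mathcal I_\Omega(m):=\mathcal F_\Omega(m)+\mathcal P_\Omega(m),\qquad \mathcal F_\Omega(m):=\iint_{\Omega\times\Omega}K(x,y)\,\psi(m(x),m(y))\,dx\,dy,$$ admits at least one minimizer in $\mathcal X^K(\Omega;\mathcal N)$. -/

import Mathlib

open MeasureTheory
open scoped ENNReal

namespace NonlocalEnergy

/-- Admissible exchange kernels `j : ℝⁿ → [0, ∞]`: (Lebesgue) measurable, even, satisfying the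
Lévy-type integrability condition, and not integrable on any ball centred at the origin. -/
structure IsExchangeKernel {n : ℕ} (j : EuclideanSpace ℝ (Fin n) → ℝ≥0∞) : Prop where
  aemeasurable : AEMeasurable j volume
  symm : ∀ z, j (-z) = j z
  levy : ∫⁻ z, ENNReal.ofReal (min 1 (‖z‖ ^ 2)) * j z < ⊤
  nonintegrable : ∀ R : ℝ, 0 < R →
    ∫⁻ z in Metric.ball (0 : EuclideanSpace ℝ (Fin n)) R, j z = ⊤

/-- `L²(Ω; 𝒩)`: the classes in `L²(Ω; ℝˡ)` that take values in `𝒩` a.e. in `Ω`.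
As a subtype it carries the strong `L²` topology. -/
def L2Valued {n l : ℕ} (Ω : Set (EuclideanSpace ℝ (Fin n))) (N : Set (EuclideanSpace ℝ (Fin l))) :
    Set (Lp (EuclideanSpace ℝ (Fin l)) 2 (volume.restrict Ω)) :=
  {m | ∀ᵐ x ∂(volume.restrict Ω), m x ∈ N}

/-- `𝒦_Ω(m) = ∬_{Ω × Ω} K(x, y) |m(x) - m(y)|² dx dy`, with values in `[0, ∞]`. -/
noncomputable def quadraticEnergy {n l : ℕ} {Ω : Set (EuclideanSpace ℝ (Fin n))}
    {N : Set (EuclideanSpace ℝ (Fin l))}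
    (K : EuclideanSpace ℝ (Fin n) → EuclideanSpace ℝ (Fin n) → ℝ≥0∞)
    (m : L2Valued Ω N) : ℝ≥0∞ :=
  ∫⁻ z, K z.1 z.2 * ENNReal.ofReal (‖m.1 z.1 - m.1 z.2‖ ^ 2)
    ∂((volume.restrict Ω).prod (volume.restrict Ω))

/-- `𝓕_Ω(m) = ∬_{Ω × Ω} K(x, y) ψ(m(x), m(y)) dx dy`, with values in `[0, ∞]`. Only the values of
`ψ` on `𝒩 × 𝒩` matter, since `m` takes values in `𝒩` almost everywhere. -/
noncomputable def interactionEnergy {n l : ℕ} {Ω : Set (EuclideanSpace ℝ (Fin n))}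
    {N : Set (EuclideanSpace ℝ (Fin l))}
    (K : EuclideanSpace ℝ (Fin n) → EuclideanSpace ℝ (Fin n) → ℝ≥0∞)
    (ψ : EuclideanSpace ℝ (Fin l) → EuclideanSpace ℝ (Fin l) → ℝ)
    (m : L2Valued Ω N) : ℝ≥0∞ :=
  ∫⁻ z, K z.1 z.2 * ENNReal.ofReal (ψ (m.1 z.1) (m.1 z.2))
    ∂((volume.restrict Ω).prod (volume.restrict Ω))

/-- The class `𝒳^K(Ω; 𝒩)` of fields in `L²(Ω; 𝒩)` with finite energy `𝒦_Ω`. -/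
def energySpace {n l : ℕ} (Ω : Set (EuclideanSpace ℝ (Fin n)))
    (N : Set (EuclideanSpace ℝ (Fin l)))
    (K : EuclideanSpace ℝ (Fin n) → EuclideanSpace ℝ (Fin n) → ℝ≥0∞) : Set (L2Valued Ω N) :=
  {m | quadraticEnergy K m < ⊤}

/-- `𝓘_Ω(m) = 𝓕_Ω(m) + 𝓟_Ω(m)`, in the extended reals (so that no convention is needed where
`𝓕_Ω(m) = ∞`). -/
noncomputable def totalEnergy {n l : ℕ} {Ω : Set (EuclideanSpace ℝ (Fin n))}
    {N : Set (EuclideanSpace ℝ (Fin l))}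
    (K : EuclideanSpace ℝ (Fin n) → EuclideanSpace ℝ (Fin n) → ℝ≥0∞)
    (ψ : EuclideanSpace ℝ (Fin l) → EuclideanSpace ℝ (Fin l) → ℝ)
    (P : L2Valued Ω N → ℝ) (m : L2Valued Ω N) : EReal :=
  (interactionEnergy K ψ m : EReal) + (P m : EReal)

end NonlocalEnergy

/-! The direct method works in the strong `L²` topology, with compactness supplied by the
non-integrability of `j`. Truncating `j` at a finite height gives a bounded kernel `J` whose
marginals `∫ J(x, y) dy` still exceed any prescribed `A` off a set of small measure near the
boundary of `Ω`. For the difference `d` of two terms of a sequence with bounded energy, expanding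
the square gives `A ∫_S |d|² ≤ ∬ J |d(x) - d(y)|² + 2 ∬ J ⟨d(x), d(y)⟩`
(`mul_setIntegral_norm_sq_le`). The first term on the right is bounded independently of `A`. The
second vanishes along a weakly convergent subsequence, because a bounded kernel on a finite measure
space defines a compact operator (`tendsto_integral_kernel_inner`). Taking `A` large, and using the
boundedness of `N` off `S`, makes that subsequence Cauchy (`exists_subseq_tendsto_Lp_of_kernel`).

Strong convergence yields a.e. convergence of a further subsequence. Hence the constraint `m ∈ N`
survives in the limit, and Fatou's lemma gives lower semicontinuity with no convexity of `ψ` or `N`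
(`lowerSemicontinuous_interactionEnergy`). -/

open Filter Topology

namespace NonlocalEnergy

/-- Bounded sequences in a separable Hilbert space have weakly convergent subsequences. -/
theorem exists_subseq_tendsto_inner {H : Type*} [NormedAddCommGroup H] [InnerProductSpace ℝ H]
    [CompleteSpace H] [TopologicalSpace.SeparableSpace H] {u : ℕ → H} {R : ℝ}
    (hu : ∀ k, ‖u k‖ ≤ R) :
    ∃ (w : H) (φ : ℕ → ℕ), StrictMono φ ∧
      ∀ g, Tendsto (fun k => inner ℝ (u (φ k)) g) atTop (𝓝 (inner ℝ w g)) := by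
  have hc := WeakDual.isSeqCompact_closedBall (𝕜 := ℝ) (E := H) 0 R
  obtain ⟨a, -, φ, hφ, ha⟩ := hc
    (x := fun k => StrongDual.toWeakDual (InnerProductSpace.toDual ℝ H (u k)))
    (fun k => by simpa using hu k)
  refine ⟨(InnerProductSpace.toDual ℝ H).symm (WeakDual.toStrongDual a), φ, hφ, fun g => ?_⟩
  have h := ((WeakDual.eval_continuous (𝕜 := ℝ) g).tendsto a).comp ha
  simpa [Function.comp_def] using h

/-! ### Strong `L²` compactness from bounded kernels -/

section Compactness

variable {X : Type*} [MeasurableSpace X] {μ : Measure X} [IsFiniteMeasure μ]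
  {E : Type*} [NormedAddCommGroup E]

theorem integrable_kernel_mul_norm_sub_sq {J : X × X → ℝ} (hJm : Measurable J) {B : ℝ}
    (hJ0 : ∀ z, 0 ≤ J z) (hJB : ∀ z, J z ≤ B)
    {d : X → E} (hdm : AEStronglyMeasurable d μ) {M : ℝ} (hdM : ∀ᵐ x ∂μ, ‖d x‖ ≤ M) :
    Integrable (fun z : X × X => J z * ‖d z.1 - d z.2‖ ^ 2) (μ.prod μ) := by
  have hJint : Integrable J (μ.prod μ) := Integrable.of_bound hJm.aestronglyMeasurable B
    (Eventually.of_forall fun z => by rw [Real.norm_of_nonneg (hJ0 z)]; exact hJB z)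
  refine hJint.mul_bdd (c := (M + M) ^ 2) ((hdm.comp_fst.sub hdm.comp_snd).norm.pow 2) ?_
  filter_upwards [Measure.quasiMeasurePreserving_fst.ae hdM,
    Measure.quasiMeasurePreserving_snd.ae hdM] with z h1 h2
  rw [norm_pow, norm_norm]
  exact pow_le_pow_left₀ (norm_nonneg _) ((norm_sub_le _ _).trans (add_le_add h1 h2)) 2

theorem integral_kernel_mul_norm_sub_sq_sub_le {J : X × X → ℝ} (hJm : Measurable J) {B : ℝ}
    (hJ0 : ∀ z, 0 ≤ J z) (hJB : ∀ z, J z ≤ B) {f g : X → E} (hfm : AEStronglyMeasurable f μ)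
    (hgm : AEStronglyMeasurable g μ) {M : ℝ} (hf : ∀ᵐ x ∂μ, ‖f x‖ ≤ M)
    (hg : ∀ᵐ x ∂μ, ‖g x‖ ≤ M) :
    ∫ z, J z * ‖(f z.1 - g z.1) - (f z.2 - g z.2)‖ ^ 2 ∂(μ.prod μ)
      ≤ 2 * ∫ z, J z * ‖f z.1 - f z.2‖ ^ 2 ∂(μ.prod μ)
        + 2 * ∫ z, J z * ‖g z.1 - g z.2‖ ^ 2 ∂(μ.prod μ) := by
  have hif := (integrable_kernel_mul_norm_sub_sq hJm hJ0 hJB hfm hf).const_mul 2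
  have hig := (integrable_kernel_mul_norm_sub_sq hJm hJ0 hJB hgm hg).const_mul 2
  have hd : ∀ᵐ x ∂μ, ‖f x - g x‖ ≤ M + M := by
    filter_upwards [hf, hg] with x h1 h2
    exact (norm_sub_le _ _).trans (add_le_add h1 h2)
  rw [← integral_const_mul, ← integral_const_mul, ← integral_add hif hig]
  have hid := integrable_kernel_mul_norm_sub_sq (d := fun x => f x - g x) hJm hJ0 hJB
    (hfm.sub hgm) hd
  refine integral_mono hid (hif.add hig) fun z => ?_
  have h1 : ‖(f z.1 - g z.1) - (f z.2 - g z.2)‖ ^ 2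
      ≤ 2 * (‖f z.1 - f z.2‖ ^ 2 + ‖g z.1 - g z.2‖ ^ 2) := by
    rw [sub_sub_sub_comm]
    exact (pow_le_pow_left₀ (norm_nonneg _) (norm_sub_le _ _) 2).trans add_sq_le
  refine (mul_le_mul_of_nonneg_left h1 (hJ0 z)).trans_eq ?_
  ring

variable [InnerProductSpace ℝ E]

/-- A bounded measurable kernel turns weak convergence to zero into convergence to zero of the
associated quadratic form. -/
theorem tendsto_integral_kernel_inner [FiniteDimensional ℝ E] {ι : Type*} [Countable ι]
    {F : Filter ι} [F.IsCountablyGenerated]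
    {J : X × X → ℝ} (hJm : Measurable J) {B : ℝ} (hJ0 : ∀ z, 0 ≤ J z) (hJB : ∀ z, J z ≤ B)
    {d : ι → X → E} (hdm : ∀ i, AEStronglyMeasurable (d i) μ) {M : ℝ} (hM : 0 ≤ M)
    (hdM : ∀ i, ∀ᵐ x ∂μ, ‖d i x‖ ≤ M)
    (hw : ∀ g : X → E, MemLp g 2 μ → Tendsto (fun i => ∫ x, inner ℝ (d i x) (g x) ∂μ) F (𝓝 0)) :
    Tendsto (fun i => ∫ z, J z * inner ℝ (d i z.1) (d i z.2) ∂(μ.prod μ)) F (𝓝 0) := by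
  have hJn : ∀ z, ‖J z‖ ≤ B := fun z => by rw [Real.norm_of_nonneg (hJ0 z)]; exact hJB z
  have hm : ∀ i, AEStronglyMeasurable (fun z : X × X => J z * inner ℝ (d i z.1) (d i z.2))
      (μ.prod μ) := fun i =>
    hJm.aestronglyMeasurable.mul ((hdm i).comp_fst.inner (hdm i).comp_snd)
  have hint : ∀ i, Integrable (fun z : X × X => J z * inner ℝ (d i z.1) (d i z.2))
      (μ.prod μ) := by
    intro i
    refine Integrable.of_bound (hm i) (B * (M * M)) ?_
    filter_upwards [Measure.quasiMeasurePreserving_fst.ae (hdM i),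
      Measure.quasiMeasurePreserving_snd.ae (hdM i)] with z h1 h2
    rw [norm_mul]
    exact mul_le_mul (hJn z) ((norm_inner_le_norm _ _).trans
      (mul_le_mul h1 h2 (norm_nonneg _) hM)) (norm_nonneg _) ((norm_nonneg _).trans (hJn z))
  have hJx : ∀ x, AEStronglyMeasurable (fun y => J (x, y)) μ := fun x =>
    (hJm.comp measurable_prodMk_left).aestronglyMeasurable
  have hbd : ∀ i x, ∀ᵐ y ∂μ, ‖J (x, y) • d i y‖ ≤ B * M := by
    intro i x
    filter_upwards [hdM i] with y hy
    rw [norm_smul]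
    exact mul_le_mul (hJn _) hy (norm_nonneg _) ((norm_nonneg _).trans (hJn (x, x)))
  have hGint : ∀ i x, Integrable (fun y => J (x, y) • d i y) μ := fun i x =>
    Integrable.of_bound ((hJx x).smul (hdm i)) (B * M) (hbd i x)
  have hG : ∀ i x, ∫ y, J (x, y) * inner ℝ (d i x) (d i y) ∂μ
      = inner ℝ (d i x) (∫ y, J (x, y) • d i y ∂μ) := by
    intro i x
    rw [← integral_inner (hGint i x)]
    simp only [inner_smul_right]
  -- For fixed `x`, each coordinate of the integral is a pairing of `d i` with the bounded, hence
  -- `L²`, field `y ↦ J (x, y) • b k`.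
  have hG0 : ∀ x, Tendsto (fun i => ∫ y, J (x, y) • d i y ∂μ) F (𝓝 0) := by
    intro x
    let b := stdOrthonormalBasis ℝ E
    have : ∀ k, Tendsto (fun i => inner ℝ (b k) (∫ y, J (x, y) • d i y ∂μ)) F (𝓝 0) := by
      intro k
      have h := hw (fun y => J (x, y) • b k) (MemLp.of_bound ((hJx x).smul_const _) (B * ‖b k‖)
        (Eventually.of_forall fun y => by
          rw [norm_smul]; exact mul_le_mul_of_nonneg_right (hJn _) (norm_nonneg _)))
      refine h.congr fun i => ?_
      rw [← integral_inner (hGint i x)]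
      refine integral_congr_ae (Eventually.of_forall fun y => ?_)
      simp only [inner_smul_right, real_inner_comm]
    have h := tendsto_finsetSum Finset.univ fun k _ => (this k).smul_const (b k)
    simpa [b.sum_repr'] using h
  simp_rw [fun i => integral_prod _ (hint i)]
  rw [← integral_zero X ℝ (μ := μ)]
  refine tendsto_integral_filter_of_dominated_convergence (fun _ => M * (B * M * μ.real Set.univ))
    (Eventually.of_forall fun i => (hm i).integral_prod_right') (Eventually.of_forall fun i => ?_)
    (integrable_const _) ?_
  · filter_upwards [hdM i] with x hx
    simp only [hG]
    exact (norm_inner_le_norm _ _).trans (mul_le_mul hx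
      (norm_integral_le_of_norm_le_const (hbd i x)) (norm_nonneg _) hM)
  · filter_upwards [ae_all_iff.2 hdM] with x hx
    simp only [hG]
    refine squeeze_zero_norm (a := fun i => M * ‖∫ y, J (x, y) • d i y ∂μ‖) (fun i =>
      (norm_inner_le_norm _ _).trans (mul_le_mul_of_nonneg_right (hx i) (norm_nonneg _))) ?_
    simpa using (hG0 x).norm.const_mul M

/-- Coercivity of a bounded kernel on a set where its marginal is bounded below, up to the
associated quadratic form. -/
theorem mul_setIntegral_norm_sq_le {J : X × X → ℝ} (hJm : Measurable J) {B : ℝ}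
    (hJ0 : ∀ z, 0 ≤ J z) (hJB : ∀ z, J z ≤ B)
    {d : X → E} (hdm : AEStronglyMeasurable d μ) {M : ℝ}
    (hdM : ∀ᵐ x ∂μ, ‖d x‖ ≤ M) {S : Set X} (hS : MeasurableSet S) {A : ℝ}
    (hA : ∀ x ∈ S, A ≤ ∫ y, J (x, y) ∂μ) :
    A * ∫ x in S, ‖d x‖ ^ 2 ∂μ ≤ ∫ z, J z * ‖d z.1 - d z.2‖ ^ 2 ∂(μ.prod μ)
      + 2 * ∫ z, J z * inner ℝ (d z.1) (d z.2) ∂(μ.prod μ) := by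
  have hJn : ∀ z, ‖J z‖ ≤ B := fun z => by rw [Real.norm_of_nonneg (hJ0 z)]; exact hJB z
  have h1 := Measure.quasiMeasurePreserving_fst (μ := μ) (ν := μ).ae hdM
  have h2 := Measure.quasiMeasurePreserving_snd (μ := μ) (ν := μ).ae hdM
  have hJint : Integrable J (μ.prod μ) :=
    Integrable.of_bound hJm.aestronglyMeasurable B (Eventually.of_forall hJn)
  have hi1 := integrable_kernel_mul_norm_sub_sq hJm hJ0 hJB hdm hdM
  have hi2 : Integrable (fun z : X × X => J z * inner ℝ (d z.1) (d z.2)) (μ.prod μ) := by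
    refine hJint.mul_bdd (c := M * M) (hdm.comp_fst.inner hdm.comp_snd) ?_
    filter_upwards [h1, h2] with z h1 h2
    exact (norm_inner_le_norm _ _).trans
      (mul_le_mul h1 h2 (norm_nonneg _) ((norm_nonneg _).trans h1))
  have hi3 : Integrable (fun z : X × X => J z * ‖d z.1‖ ^ 2) (μ.prod μ) := by
    refine hJint.mul_bdd (c := M ^ 2) (hdm.comp_fst.norm.pow 2) ?_
    filter_upwards [h1] with z h1
    rw [norm_pow, norm_norm]
    exact pow_le_pow_left₀ (norm_nonneg _) h1 2
  have hi4 : Integrable (fun x => ‖d x‖ ^ 2) μ := by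
    refine Integrable.of_bound (hdm.norm.pow 2) (M ^ 2) ?_
    filter_upwards [hdM] with x h1
    rw [norm_pow, norm_norm]
    exact pow_le_pow_left₀ (norm_nonneg _) h1 2
  have hi5 : Integrable (fun x => (∫ y, J (x, y) ∂μ) * ‖d x‖ ^ 2) μ := by
    simpa only [integral_mul_const] using hi3.integral_prod_left
  calc A * ∫ x in S, ‖d x‖ ^ 2 ∂μ = ∫ x in S, A * ‖d x‖ ^ 2 ∂μ := (integral_const_mul _ _).symm
    _ ≤ ∫ x in S, (∫ y, J (x, y) ∂μ) * ‖d x‖ ^ 2 ∂μ :=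
        setIntegral_mono_on (hi4.const_mul A).integrableOn hi5.integrableOn hS fun x hx =>
          mul_le_mul_of_nonneg_right (hA x hx) (by positivity)
    _ ≤ ∫ x, (∫ y, J (x, y) ∂μ) * ‖d x‖ ^ 2 ∂μ :=
        setIntegral_le_integral hi5 (Eventually.of_forall fun x =>
          mul_nonneg (integral_nonneg fun y => hJ0 _) (by positivity))
    _ = ∫ z, J z * ‖d z.1‖ ^ 2 ∂(μ.prod μ) := by
        rw [integral_prod _ hi3]
        simp only [integral_mul_const]
    -- Expand the square and drop the nonnegative term `J |d(y)|²`.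
    _ ≤ ∫ z, (J z * ‖d z.1 - d z.2‖ ^ 2 + 2 * (J z * inner ℝ (d z.1) (d z.2))) ∂(μ.prod μ) := by
        refine integral_mono hi3 (hi1.add (hi2.const_mul 2)) fun z => ?_
        have := norm_sub_sq_real (d z.1) (d z.2)
        have := mul_nonneg (hJ0 z) (sq_nonneg ‖d z.2‖)
        simp only [norm_sub_sq_real]
        linarith
    _ = _ := by rw [integral_add hi1 (hi2.const_mul 2), integral_const_mul]

/-- **Nonlocal compactness criterion.** A bounded sequence whose nonlocal energies are bounded,
uniformly over bounded kernels with arbitrarily large marginals off sets of arbitrarily small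
measure, has a subsequence converging strongly in `L²`. -/
theorem exists_subseq_tendsto_Lp_of_kernel [FiniteDimensional ℝ E]
    [TopologicalSpace.SeparableSpace (Lp E 2 μ)]
    {u : ℕ → Lp E 2 μ} {M C : ℝ} (hM : 0 ≤ M) (huM : ∀ k, ∀ᵐ x ∂μ, ‖u k x‖ ≤ M)
    (hJ : ∀ ε > 0, ∀ A : ℝ, ∃ S, MeasurableSet S ∧ μ.real Sᶜ ≤ ε ∧ ∃ (J : X × X → ℝ) (B : ℝ),
      Measurable J ∧ (∀ z, 0 ≤ J z) ∧ (∀ z, J z ≤ B) ∧ (∀ x ∈ S, A ≤ ∫ y, J (x, y) ∂μ) ∧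
      ∀ k, ∫ z, J z * ‖u k z.1 - u k z.2‖ ^ 2 ∂(μ.prod μ) ≤ C) :
    ∃ (w : Lp E 2 μ) (φ : ℕ → ℕ), StrictMono φ ∧ Tendsto (fun k => u (φ k)) atTop (𝓝 w) := by
  have hd : ∀ a b, ∀ᵐ x ∂μ, ‖u a x - u b x‖ ≤ M + M := fun a b => by
    filter_upwards [huM a, huM b] with x h1 h2
    exact (norm_sub_le _ _).trans (add_le_add h1 h2)
  have hdm : ∀ a b, AEStronglyMeasurable (fun x => u a x - u b x) μ := fun a b =>
    (Lp.aestronglyMeasurable _).sub (Lp.aestronglyMeasurable _)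
  obtain ⟨v, φ, hφ, hv⟩ := exists_subseq_tendsto_inner (u := u)
    (fun k => Lp.norm_le_of_ae_bound hM (huM k))
  suffices h : CauchySeq fun k => u (φ k) by
    obtain ⟨w, hw⟩ := cauchySeq_tendsto_of_complete h
    exact ⟨w, φ, hφ, hw⟩
  -- Working with pairs of indices cancels the weak limit, so nothing about its energy or pointwise
  -- bound is needed.
  have hweak : ∀ g : X → E, MemLp g 2 μ → Tendsto (fun p : ℕ × ℕ =>
      ∫ x, inner ℝ (u (φ p.1) x - u (φ p.2) x) (g x) ∂μ) atTop (𝓝 0) := by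
    intro g hg
    have h := ((hv (hg.toLp g)).comp (tendsto_fst (f := atTop) (g := atTop))).sub
      ((hv (hg.toLp g)).comp (tendsto_snd (f := atTop) (g := atTop)))
    rw [prod_atTop_atTop_eq] at h
    rw [sub_self] at h
    refine h.congr fun p => ?_
    simp only [Function.comp_apply]
    rw [← inner_sub_left, L2.inner_def]
    refine integral_congr_ae ?_
    filter_upwards [Lp.coeFn_sub (u (φ p.1)) (u (φ p.2)), hg.coeFn_toLp] with x h1 h2
    rw [h1, h2, Pi.sub_apply]
  have hnorm : ∀ a b, dist (u a) (u b) ^ 2 = ∫ x, ‖u a x - u b x‖ ^ 2 ∂μ := by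
    intro a b
    rw [dist_eq_norm, ← real_inner_self_eq_norm_sq, L2.inner_def]
    refine integral_congr_ae ?_
    filter_upwards [Lp.coeFn_sub (u a) (u b)] with x h1
    rw [h1, Pi.sub_apply, real_inner_self_eq_norm_sq]
  have hsq : ∀ a b, Integrable (fun x => ‖u a x - u b x‖ ^ 2) μ := by
    intro a b
    refine Integrable.of_bound ((hdm a b).norm.pow 2) ((M + M) ^ 2) ?_
    filter_upwards [hd a b] with x h1
    rw [norm_pow, norm_norm]
    exact pow_le_pow_left₀ (norm_nonneg _) h1 2
  rw [cauchySeq_iff_tendsto_dist_atTop_0]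
  suffices h : Tendsto (fun p : ℕ × ℕ => dist (u (φ p.1)) (u (φ p.2)) ^ 2) atTop (𝓝 0) by
    simpa [Real.sqrt_sq dist_nonneg] using h.sqrt
  suffices h : ∀ δ > 0, ∀ᶠ p : ℕ × ℕ in atTop, dist (u (φ p.1)) (u (φ p.2)) ^ 2 ≤ δ from
    tendsto_order.2 ⟨fun a ha => Eventually.of_forall fun p => ha.trans_le (sq_nonneg _),
      fun δ hδ => (h (δ / 2) (half_pos hδ)).mono fun p hp => hp.trans_lt (half_lt_self hδ)⟩
  intro δ hδ
  -- Each of `Sᶜ` and `S` is to contribute at most `δ / 2`. The `+ 1` keeps the denominator positive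
  -- when `M = 0`. In the choice of `A`, `4 * |C|` bounds the energy of the difference and `2` is
  -- twice the eventual bound `1` on the quadratic form.
  obtain ⟨S, hS, hSε, J, B, hJm, hJ0, hJB, hJA, hJC⟩ :=
    hJ (δ / 2 / ((M + M) ^ 2 + 1)) (by positivity) ((4 * |C| + 2) / (δ / 2))
  have hquad := tendsto_integral_kernel_inner hJm hJ0 hJB (fun p : ℕ × ℕ => hdm (φ p.1) (φ p.2))
    (add_nonneg hM hM) (fun p => hd _ _) hweak
  filter_upwards [hquad.eventually_le_const one_pos] with p hp
  have hcoer := mul_setIntegral_norm_sq_le hJm hJ0 hJB (hdm (φ p.1) (φ p.2)) (hd _ _) hS hJA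
  have henergy := (integral_kernel_mul_norm_sub_sq_sub_le hJm hJ0 hJB
    (Lp.aestronglyMeasurable (u (φ p.1))) (Lp.aestronglyMeasurable (u (φ p.2))) (huM _)
    (huM _)).trans (add_le_add (mul_le_mul_of_nonneg_left (hJC _) zero_le_two)
      (mul_le_mul_of_nonneg_left (hJC _) zero_le_two))
  have hSc : ∫ x in Sᶜ, ‖u (φ p.1) x - u (φ p.2) x‖ ^ 2 ∂μ ≤ δ / 2 := by
    calc _ ≤ ∫ x in Sᶜ, (M + M) ^ 2 ∂μ := by
          refine setIntegral_mono_ae (hsq _ _).integrableOn (integrable_const _).integrableOn ?_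
          filter_upwards [hd (φ p.1) (φ p.2)] with x hx
          exact pow_le_pow_left₀ (norm_nonneg _) hx 2
      _ = μ.real Sᶜ * (M + M) ^ 2 := by rw [setIntegral_const, smul_eq_mul]
      _ ≤ δ / 2 / ((M + M) ^ 2 + 1) * ((M + M) ^ 2 + 1) :=
          mul_le_mul hSε (by linarith) (by positivity) (by positivity)
      _ = δ / 2 := div_mul_cancel₀ _ (by positivity)
  have hSi : ∫ x in S, ‖u (φ p.1) x - u (φ p.2) x‖ ^ 2 ∂μ ≤ δ / 2 := by
    have h := hcoer.trans (add_le_add henergy (mul_le_mul_of_nonneg_left hp zero_le_two))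
    have hC := le_abs_self C
    rw [div_mul_eq_mul_div, div_le_iff₀ (by positivity)] at h
    have hpos : (0 : ℝ) < 4 * |C| + 2 := by positivity
    refine le_of_mul_le_mul_left (h.trans ?_) hpos
    exact mul_le_mul_of_nonneg_right (by linarith) (by positivity)
  rw [hnorm, ← integral_add_compl hS (hsq _ _)]
  linarith

end Compactness
-- Bounded minorants of a non-integrable kernel
theorem exists_measurableSet_ball_subset {n : ℕ} {Ω : Set (EuclideanSpace ℝ (Fin n))}
    (hΩ : IsOpen Ω) [IsFiniteMeasure (volume.restrict Ω)] {ε : ℝ} (hε : 0 < ε) :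
    ∃ r > 0, ∃ S, MeasurableSet S ∧ (volume.restrict Ω).real Sᶜ ≤ ε ∧
      ∀ x ∈ S, Metric.ball x r ⊆ Ω := by
  -- Points at distance at least `1 / (k + 1)` from `Ωᶜ`; since `Ω` is open, these sets exhaust it.
  let S : ℕ → Set (EuclideanSpace ℝ (Fin n)) :=
    fun k => {x | ENNReal.ofReal (1 / ((k : ℝ) + 1)) ≤ Metric.infEDist x Ωᶜ}
  have hS : ∀ k, MeasurableSet (S k) := fun k =>
    (isClosed_le continuous_const Metric.continuous_infEDist).measurableSet
  have hanti : Antitone fun k => (S k)ᶜ := fun a b hab => Set.compl_subset_compl.2 fun x hx =>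
    (ENNReal.ofReal_le_ofReal (Nat.one_div_le_one_div hab)).trans hx
  have hzero : volume.restrict Ω (⋂ k, (S k)ᶜ) = 0 := by
    rw [Measure.restrict_apply (MeasurableSet.iInter fun k => (hS k).compl)]
    convert measure_empty (μ := volume)
    refine Set.eq_empty_of_forall_notMem fun x hx => ?_
    obtain ⟨δ, hδ, hball⟩ := Metric.isOpen_iff.1 hΩ x hx.2
    obtain ⟨k, hk⟩ := exists_nat_one_div_lt hδ
    refine Set.mem_iInter.1 hx.1 k (Metric.le_infEDist.2 fun y hy => ?_)
    rw [edist_dist]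
    refine ENNReal.ofReal_le_ofReal (hk.le.trans ?_)
    by_contra! h
    exact hy (hball (by rwa [Metric.mem_ball, dist_comm]))
  have hlim := tendsto_measure_iInter_atTop (μ := volume.restrict Ω)
    (fun k => (hS k).compl.nullMeasurableSet) hanti ⟨0, measure_ne_top _ _⟩
  rw [hzero] at hlim
  obtain ⟨k, hk⟩ := (hlim.eventually_le_const (ENNReal.ofReal_pos.2 hε)).exists
  refine ⟨1 / ((k : ℝ) + 1), by positivity, S k, hS k, ENNReal.toReal_le_of_le_ofReal hε.le hk,
    fun x hx y hy => ?_⟩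
  by_contra h
  have h1 := hx.trans (Metric.infEDist_le_edist_of_mem h)
  rw [edist_dist, ENNReal.ofReal_le_ofReal_iff dist_nonneg, dist_comm] at h1
  exact not_lt.2 h1 hy

theorem exists_nat_le_setLIntegral_min {X : Type*} [MeasurableSpace X] {μ : Measure X}
    {f : X → ℝ≥0∞} (hf : Measurable f) (h : ∫⁻ x, f x ∂μ = ⊤) (A : ℝ) :
    ∃ k : ℕ, ENNReal.ofReal A ≤ ∫⁻ x, min (f x) k ∂μ := by
  have hsup : ⨆ k : ℕ, ∫⁻ x, min (f x) k ∂μ = ⊤ := by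
    rw [← lintegral_iSup (fun k => hf.min measurable_const)
      fun a b hab x => min_le_min_left _ (Nat.cast_le.2 hab), ← h]
    simp only [← inf_iSup_eq, ENNReal.iSup_natCast, inf_top_eq]
  obtain ⟨k, hk⟩ := lt_iSup_iff.1 (hsup ▸ ENNReal.ofReal_lt_top : ENNReal.ofReal A < _)
  exact ⟨k, hk.le⟩

/-- A kernel which is not integrable near the origin admits bounded translation-invariant minorants
with arbitrarily large marginals off sets of arbitrarily small measure. -/
theorem exists_bounded_minorant {n : ℕ} {Ω : Set (EuclideanSpace ℝ (Fin n))}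
    (hΩ : IsOpen Ω) [IsFiniteMeasure (volume.restrict Ω)]
    {j : EuclideanSpace ℝ (Fin n) → ℝ≥0∞} (hj : AEMeasurable j)
    (hj' : ∀ R : ℝ, 0 < R → ∫⁻ z in Metric.ball 0 R, j z = ⊤) {ε : ℝ} (hε : 0 < ε) (A : ℝ) :
    ∃ S, MeasurableSet S ∧ (volume.restrict Ω).real Sᶜ ≤ ε ∧
      ∃ (J : EuclideanSpace ℝ (Fin n) × EuclideanSpace ℝ (Fin n) → ℝ) (B : ℝ), Measurable J ∧
        (∀ z, 0 ≤ J z) ∧ (∀ z, J z ≤ B) ∧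
        (∀ x ∈ S, A ≤ ∫ y, J (x, y) ∂(volume.restrict Ω)) ∧
        ∀ᵐ z ∂((volume.restrict Ω).prod (volume.restrict Ω)),
          ENNReal.ofReal (J z) ≤ j (z.1 - z.2) := by
  obtain ⟨r, hr, S, hS, hSε, hball⟩ := exists_measurableSet_ball_subset hΩ hε
  -- As `j` is only a.e. measurable, truncation is applied to a Borel representative; the
  -- exceptional null set is pulled back through `(x, y) ↦ x - y` at the end.
  have hmk : ∫⁻ z in Metric.ball 0 r, hj.mk j z = ⊤ := by
    rw [← hj' r hr]
    exact lintegral_congr_ae (ae_restrict_of_ae hj.ae_eq_mk.symm)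
  obtain ⟨k, hk⟩ := exists_nat_le_setLIntegral_min hj.measurable_mk hmk A
  let g : EuclideanSpace ℝ (Fin n) → ℝ≥0∞ := fun z => min (hj.mk j z) k
  have hg : Measurable g := hj.measurable_mk.min measurable_const
  have hgk : ∀ z, g z ≤ k := fun z => min_le_right _ _
  have hgtop : ∀ z, g z ≠ ⊤ := fun z => ne_top_of_le_ne_top (ENNReal.natCast_ne_top k) (hgk z)
  refine ⟨S, hS, hSε, fun z => (g (z.1 - z.2)).toReal, k,
    (hg.comp (measurable_fst.sub measurable_snd)).ennreal_toReal,
    fun z => ENNReal.toReal_nonneg,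
    fun z => by simpa using ENNReal.toReal_mono (ENNReal.natCast_ne_top k) (hgk (z.1 - z.2)),
    fun x hx => ?_, ?_⟩
  · have hgx : Measurable fun y => g (x - y) := hg.comp (measurable_const.sub measurable_id)
    rw [integral_toReal hgx.aemeasurable (Eventually.of_forall fun y => (hgtop _).lt_top)]
    have hfin : ∫⁻ y in Ω, g (x - y) ≠ ⊤ := by
      refine ne_top_of_le_ne_top ?_ (lintegral_mono fun y => hgk (x - y))
      rw [lintegral_const]
      exact ENNReal.mul_ne_top (ENNReal.natCast_ne_top k) (measure_ne_top _ _)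
    refine (ENNReal.ofReal_le_iff_le_toReal hfin).1 (hk.trans ?_)
    calc ∫⁻ z in Metric.ball 0 r, g z
        = ∫⁻ z, (Metric.ball 0 r).indicator g z := (lintegral_indicator measurableSet_ball _).symm
      _ = ∫⁻ y, (Metric.ball 0 r).indicator g (x - y) :=
          (lintegral_sub_left_eq_self _ x).symm
      _ = ∫⁻ y, (Metric.ball x r).indicator (fun y => g (x - y)) y := by
          classical
          refine lintegral_congr fun y => ?_
          simp only [Set.indicator_apply, Metric.mem_ball, dist_eq_norm', zero_sub, norm_neg]
      _ = ∫⁻ y in Metric.ball x r, g (x - y) := lintegral_indicator measurableSet_ball _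
      _ ≤ ∫⁻ y in Ω, g (x - y) := lintegral_mono_set (hball x hx)
  · have hac : (volume.restrict Ω).prod (volume.restrict Ω) ≪ (volume.prod volume :
        Measure (EuclideanSpace ℝ (Fin n) × EuclideanSpace ℝ (Fin n))) :=
      Measure.restrict_le_self.absolutelyContinuous.prod
        Measure.restrict_le_self.absolutelyContinuous
    have hae := hac.ae_le ((quasiMeasurePreserving_sub_of_right_invariant volume volume).ae
      hj.ae_eq_mk)
    filter_upwards [hae] with z hz
    rw [ENNReal.ofReal_toReal (hgtop _), hz]
    exact min_le_left _ _

/-! ### Semicontinuity, coercivity and compact sublevel sets -/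

section Energy

variable {n l : ℕ} {Ω : Set (EuclideanSpace ℝ (Fin n))} {N : Set (EuclideanSpace ℝ (Fin l))}
  {K : EuclideanSpace ℝ (Fin n) → EuclideanSpace ℝ (Fin n) → ℝ≥0∞}
  {ψ : EuclideanSpace ℝ (Fin l) → EuclideanSpace ℝ (Fin l) → ℝ}

theorem ae_fst_mem (m : L2Valued Ω N) :
    ∀ᵐ z ∂((volume.restrict Ω).prod (volume.restrict Ω)), m.1 z.1 ∈ N :=
  Measure.quasiMeasurePreserving_fst.ae m.2

theorem ae_snd_mem (m : L2Valued Ω N) :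
    ∀ᵐ z ∂((volume.restrict Ω).prod (volume.restrict Ω)), m.1 z.2 ∈ N :=
  Measure.quasiMeasurePreserving_snd.ae m.2

theorem exists_subseq_tendsto_ae {X E : Type*} [MeasurableSpace X] {μ : Measure X}
    [NormedAddCommGroup E] {u : ℕ → Lp E 2 μ} {w : Lp E 2 μ} (h : Tendsto u atTop (𝓝 w)) :
    ∃ φ : ℕ → ℕ, StrictMono φ ∧ ∀ᵐ x ∂μ, Tendsto (fun k => u (φ k) x) atTop (𝓝 (w x)) :=
  (tendstoInMeasure_of_tendsto_Lp h).exists_seq_tendsto_ae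

theorem isClosed_L2Valued (hN : IsClosed N) : IsClosed (L2Valued Ω N) := by
  refine IsSeqClosed.isClosed fun u w hu hw => ?_
  obtain ⟨φ, -, hφ⟩ := exists_subseq_tendsto_ae hw
  filter_upwards [hφ, ae_all_iff.2 hu] with x hx hux
  exact hN.mem_of_tendsto hx (Eventually.of_forall fun k => hux _)

theorem aemeasurable_interactionEnergy_integrand (hN : IsCompact N)
    (hK : AEMeasurable (fun z : EuclideanSpace ℝ (Fin n) × EuclideanSpace ℝ (Fin n) =>
      K z.1 z.2) ((volume.restrict Ω).prod (volume.restrict Ω)))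
    (hψ : ContinuousOn
      (fun p : EuclideanSpace ℝ (Fin l) × EuclideanSpace ℝ (Fin l) => ψ p.1 p.2) (N ×ˢ N))
    (m : L2Valued Ω N) :
    AEMeasurable (fun z : EuclideanSpace ℝ (Fin n) × EuclideanSpace ℝ (Fin n) =>
      K z.1 z.2 * ENNReal.ofReal (ψ (m.1 z.1) (m.1 z.2)))
      ((volume.restrict Ω).prod (volume.restrict Ω)) := by
  classical
  -- Nothing is known about `ψ` off `N ×ˢ N`, so it is replaced there by zero.
  have hψm : Measurable ((N ×ˢ N).piecewise
      (fun p : EuclideanSpace ℝ (Fin l) × EuclideanSpace ℝ (Fin l) => ψ p.1 p.2) fun _ => 0) :=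
    hψ.measurable_piecewise continuousOn_const (hN.measurableSet.prod hN.measurableSet)
  have hm := (Lp.aestronglyMeasurable m.1).aemeasurable
  have hcomp := hψm.comp_aemeasurable (hm.comp_fst (ν := volume.restrict Ω)
    |>.prodMk (hm.comp_snd (μ := volume.restrict Ω)))
  refine (hK.mul hcomp.ennreal_ofReal).congr ?_
  filter_upwards [ae_fst_mem m, ae_snd_mem m] with z h1 h2
  simp [h1, h2]

theorem lowerSemicontinuous_interactionEnergy (hN : IsCompact N)
    (hK : AEMeasurable (fun z : EuclideanSpace ℝ (Fin n) × EuclideanSpace ℝ (Fin n) =>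
      K z.1 z.2) ((volume.restrict Ω).prod (volume.restrict Ω)))
    (hψ : ContinuousOn
      (fun p : EuclideanSpace ℝ (Fin l) × EuclideanSpace ℝ (Fin l) => ψ p.1 p.2) (N ×ˢ N)) :
    LowerSemicontinuous (interactionEnergy K ψ : L2Valued Ω N → ℝ≥0∞) := by
  refine lowerSemicontinuous_iff_isClosed_preimage.2 fun c => IsSeqClosed.isClosed ?_
  intro u w hu hw
  obtain ⟨φ, -, hφ⟩ := exists_subseq_tendsto_ae ((continuous_subtype_val.tendsto w).comp hw)
  have hle : ∀ᵐ z ∂((volume.restrict Ω).prod (volume.restrict Ω)),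
      K z.1 z.2 * ENNReal.ofReal (ψ (w.1 z.1) (w.1 z.2)) ≤
        liminf (fun k => K z.1 z.2 * ENNReal.ofReal
          (ψ ((u (φ k)).1 z.1) ((u (φ k)).1 z.2))) atTop := by
    filter_upwards [Measure.quasiMeasurePreserving_fst.ae hφ,
      Measure.quasiMeasurePreserving_snd.ae hφ, ae_fst_mem w, ae_snd_mem w,
      ae_all_iff.2 fun k => ae_fst_mem (u (φ k)),
      ae_all_iff.2 fun k => ae_snd_mem (u (φ k))] with z h1 h2 h3 h4 h5 h6
    have hpair : Tendsto (fun k => ((u (φ k)).1 z.1, (u (φ k)).1 z.2)) atTop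
        (𝓝[N ×ˢ N] (w.1 z.1, w.1 z.2)) :=
      tendsto_nhdsWithin_iff.2 ⟨h1.prodMk_nhds h2, Eventually.of_forall fun k => ⟨h5 k, h6 k⟩⟩
    have hlim := ENNReal.tendsto_ofReal ((hψ _ ⟨h3, h4⟩).tendsto.comp hpair)
    -- Where `K = ∞`, multiplication by `K` is discontinuous at zero, but there the left-hand side
    -- is `∞ * 0 = 0`.
    rcases eq_or_ne (ENNReal.ofReal (ψ (w.1 z.1) (w.1 z.2))) 0 with h0 | h0
    · simp [h0]
    · exact (ENNReal.Tendsto.const_mul hlim (Or.inl h0)).liminf_eq.ge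
  calc interactionEnergy K ψ w
      ≤ _ := lintegral_mono_ae hle
    _ ≤ liminf (fun k => interactionEnergy K ψ (u (φ k))) atTop :=
        lintegral_liminf_le' fun k => aemeasurable_interactionEnergy_integrand hN hK hψ _
    _ ≤ liminf (fun _ : ℕ => c) atTop :=
        liminf_le_liminf (Eventually.of_forall fun k => hu (φ k))
    _ = c := liminf_const c

theorem mul_quadraticEnergy_le_interactionEnergy {Λ : ℝ}
    (hψ : ∀ p ∈ N, ∀ q ∈ N, 1 / Λ * ‖p - q‖ ^ 2 ≤ ψ p q) (hΛ : 0 < Λ) (m : L2Valued Ω N) :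
    ENNReal.ofReal (1 / Λ) * quadraticEnergy K m ≤ interactionEnergy K ψ m := by
  rw [quadraticEnergy, ← lintegral_const_mul' _ _ ENNReal.ofReal_ne_top]
  refine lintegral_mono_ae ?_
  filter_upwards [ae_fst_mem m, ae_snd_mem m] with z h1 h2
  rw [mul_left_comm, ← ENNReal.ofReal_mul (by positivity)]
  exact mul_le_mul_right (ENNReal.ofReal_le_ofReal (hψ _ h1 _ h2)) _

theorem mul_quadraticEnergy_le_of_ae_le {J : EuclideanSpace ℝ (Fin n) →
      EuclideanSpace ℝ (Fin n) → ℝ≥0∞} {c : ℝ≥0∞} (hc : c ≠ ⊤)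
    (h : ∀ᵐ z ∂((volume.restrict Ω).prod (volume.restrict Ω)), c * J z.1 z.2 ≤ K z.1 z.2)
    (m : L2Valued Ω N) : c * quadraticEnergy J m ≤ quadraticEnergy K m := by
  rw [quadraticEnergy, ← lintegral_const_mul' _ _ hc]
  refine lintegral_mono_ae ?_
  filter_upwards [h] with z h1
  rw [← mul_assoc]
  exact mul_le_mul_left h1 _

/-- Sublevel sets of the quadratic energy of a non-integrable kernel are relatively compact. -/
theorem exists_subseq_tendsto_of_quadraticEnergy_le (hΩ : IsOpen Ω)
    [IsFiniteMeasure (volume.restrict Ω)] (hN : IsCompact N)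
    {j : EuclideanSpace ℝ (Fin n) → ℝ≥0∞} (hj : AEMeasurable j)
    (hj' : ∀ R : ℝ, 0 < R → ∫⁻ z in Metric.ball 0 R, j z = ⊤) {c : ℝ≥0∞} (hc : c ≠ ⊤)
    {u : ℕ → L2Valued Ω N} (hu : ∀ k, quadraticEnergy (fun x y => j (x - y)) (u k) ≤ c) :
    ∃ (w : L2Valued Ω N) (φ : ℕ → ℕ), StrictMono φ ∧
      Tendsto (fun k => u (φ k)) atTop (𝓝 w) := by
  have : Fact ((2 : ℝ≥0∞) ≠ ⊤) := ⟨ENNReal.ofNat_ne_top⟩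
  obtain ⟨M, hM, hNM⟩ := hN.isBounded.exists_pos_norm_le
  have hub : ∀ k, ∀ᵐ x ∂(volume.restrict Ω), ‖(u k).1 x‖ ≤ M := fun k => by
    filter_upwards [(u k).2] with x hx using hNM _ hx
  obtain ⟨w, φ, hφ, hw⟩ := exists_subseq_tendsto_Lp_of_kernel (u := fun k => (u k).1)
    (C := c.toReal) hM.le hub (by
      intro ε hε A
      obtain ⟨S, hS, hSε, J, B, hJm, hJ0, hJB, hJA, hJj⟩ := exists_bounded_minorant hΩ hj hj' hε A
      refine ⟨S, hS, hSε, J, B, hJm, hJ0, hJB, hJA, fun k => ?_⟩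
      have hum := Lp.aestronglyMeasurable (u k).1
      rw [integral_eq_lintegral_of_nonneg_ae
        (Eventually.of_forall fun z => mul_nonneg (hJ0 z) (sq_nonneg _))
        (integrable_kernel_mul_norm_sub_sq hJm hJ0 hJB hum (hub k)).aestronglyMeasurable]
      refine ENNReal.toReal_mono hc (le_trans (lintegral_mono_ae ?_) (hu k))
      filter_upwards [hJj] with z hz
      rw [ENNReal.ofReal_mul (hJ0 z)]
      exact mul_le_mul_left hz _)
  have hwN : w ∈ L2Valued Ω N := (isClosed_L2Valued hN.isClosed).mem_of_tendsto hw
    (Eventually.of_forall fun k => (u (φ k)).2)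
  exact ⟨⟨w, hwN⟩, φ, hφ, tendsto_subtype_rng.2 hw⟩

theorem exists_interactionEnergy_eq_zero [IsFiniteMeasure (volume.restrict Ω)]
    (hN : N.Nonempty) (hψ : ∀ p ∈ N, ψ p p ≤ 0) :
    ∃ m : L2Valued Ω N, interactionEnergy K ψ m = 0 := by
  obtain ⟨p, hp⟩ := hN
  have hm : MemLp (fun _ => p) 2 (volume.restrict Ω) := memLp_const p
  refine ⟨⟨hm.toLp, ?_⟩, ?_⟩
  · filter_upwards [hm.coeFn_toLp] with x hx
    rwa [hx]
  · rw [interactionEnergy, ← lintegral_zero]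
    refine lintegral_congr_ae ?_
    filter_upwards [Measure.quasiMeasurePreserving_fst.ae hm.coeFn_toLp,
      Measure.quasiMeasurePreserving_snd.ae hm.coeFn_toLp] with z h1 h2
    rw [h1, h2, ENNReal.ofReal_of_nonpos (hψ p hp), mul_zero]

/-- Subtracting a lower bound of `P` moves the minimization from `EReal` to `ℝ≥0∞`. -/
theorem totalEnergy_eq (P : L2Valued Ω N → ℝ) {b : ℝ} (hb : ∀ m, b ≤ P m) (m : L2Valued Ω N) :
    totalEnergy K ψ P m
      = ((interactionEnergy K ψ m + ENNReal.ofReal (P m - b) : ℝ≥0∞) : EReal) + (b : EReal) := by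
  rw [totalEnergy, EReal.coe_ennreal_add, EReal.coe_ennreal_ofReal,
    max_eq_left (sub_nonneg.2 (hb m)), add_assoc, ← EReal.coe_add, sub_add_cancel]

end Energy

end NonlocalEnergy

/-! ### The direct method -/

open NonlocalEnergy in
theorem mainTheorem2 {n l : ℕ}
    (Ω : Set (EuclideanSpace ℝ (Fin n))) (hΩ_open : IsOpen Ω) (hΩ_bdd : Bornology.IsBounded Ω)
    (N : Set (EuclideanSpace ℝ (Fin l))) (hN_compact : IsCompact N) (hN_nonempty : N.Nonempty)
    (j : EuclideanSpace ℝ (Fin n) → ℝ≥0∞) (hj : NonlocalEnergy.IsExchangeKernel j)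
    (K : EuclideanSpace ℝ (Fin n) → EuclideanSpace ℝ (Fin n) → ℝ≥0∞)
    (hK_meas : AEMeasurable (fun z : EuclideanSpace ℝ (Fin n) × EuclideanSpace ℝ (Fin n) =>
      K z.1 z.2) ((volume.restrict Ω).prod (volume.restrict Ω)))
    (ψ : EuclideanSpace ℝ (Fin l) → EuclideanSpace ℝ (Fin l) → ℝ)
    (hψ_cont : ContinuousOn
      (fun p : EuclideanSpace ℝ (Fin l) × EuclideanSpace ℝ (Fin l) => ψ p.1 p.2) (N ×ˢ N))
    (Λ : ℝ) (hΛ : 1 ≤ Λ)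
    (hψ_growth : ∀ p ∈ N, ∀ q ∈ N,
      1 / Λ * ‖p - q‖ ^ 2 ≤ ψ p q ∧ ψ p q ≤ Λ * ‖p - q‖ ^ 2)
    (hK_growth : ∀ᵐ z ∂((volume.restrict Ω).prod (volume.restrict Ω)),
      ENNReal.ofReal (1 / Λ) * j (z.1 - z.2) ≤ K z.1 z.2)
    (P : NonlocalEnergy.L2Valued Ω N → ℝ) (hP_bdd : BddBelow (Set.range P))
    (hP_cont : Continuous P) :
    ∃ m ∈ NonlocalEnergy.energySpace Ω N K,
      IsMinOn (NonlocalEnergy.totalEnergy K ψ P) (NonlocalEnergy.energySpace Ω N K) m := by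
  have hΛ0 : 0 < Λ := one_pos.trans_le hΛ
  have : IsFiniteMeasure (volume.restrict Ω) := isFiniteMeasure_restrict.2 hΩ_bdd.measure_lt_top.ne
  have hΛ1 : ENNReal.ofReal (1 / Λ) ≠ 0 := (ENNReal.ofReal_pos.2 (by positivity)).ne'
  obtain ⟨b, hb⟩ := hP_bdd
  replace hb : ∀ m, b ≤ P m := fun m => hb ⟨m, rfl⟩
  have hquad := fun m : L2Valued Ω N => mul_quadraticEnergy_le_interactionEnergy (K := K)
    (fun p hp q hq => (hψ_growth p hp q hq).1) hΛ0 m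
  let G : L2Valued Ω N → ℝ≥0∞ := fun m => interactionEnergy K ψ m + ENNReal.ofReal (P m - b)
  have hG : LowerSemicontinuous G :=
    (lowerSemicontinuous_interactionEnergy hN_compact hK_meas hψ_cont).add
      (ENNReal.continuous_ofReal.comp (hP_cont.sub continuous_const)).lowerSemicontinuous
  -- A constant field is a competitor of finite energy: the upper growth bound at `p = q` gives `ψ p
  -- p ≤ 0`.
  obtain ⟨m₀, hm₀⟩ := exists_interactionEnergy_eq_zero (K := K) (Ω := Ω) (ψ := ψ) hN_nonempty
    fun p hp => by simpa using (hψ_growth p hp p hp).2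
  have hG₀ : G m₀ ≠ ⊤ := by simp [G, hm₀]
  have hcompact : IsCompact {m | G m ≤ G m₀} := by
    refine IsSeqCompact.isCompact fun u hu => ?_
    obtain ⟨w, φ, hφ, hw⟩ := exists_subseq_tendsto_of_quadraticEnergy_le hΩ_open hN_compact
      hj.aemeasurable hj.nonintegrable
      -- One factor `1 / Λ` is lost from `ψ` to `|p - q|²`, the other from `K` to `j`.
      (c := G m₀ / ENNReal.ofReal (1 / Λ) / ENNReal.ofReal (1 / Λ)) (u := u)
      (ENNReal.div_ne_top (ENNReal.div_ne_top hG₀ hΛ1) hΛ1) (fun k => by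
        rw [ENNReal.le_div_iff_mul_le (Or.inl hΛ1) (Or.inl ENNReal.ofReal_ne_top),
          ENNReal.le_div_iff_mul_le (Or.inl hΛ1) (Or.inl ENNReal.ofReal_ne_top), mul_comm,
          mul_comm _ (ENNReal.ofReal _)]
        exact (mul_le_mul_right (mul_quadraticEnergy_le_of_ae_le ENNReal.ofReal_ne_top
          hK_growth (u k)) _).trans ((hquad (u k)).trans (le_self_add.trans (hu k))))
    exact ⟨w, (hG.isClosed_preimage (G m₀)).mem_of_tendsto hw
      (Eventually.of_forall fun k => hu (φ k)), φ, hφ, hw⟩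
  obtain ⟨m, hm, hmin⟩ := (hG.lowerSemicontinuousOn _).exists_isMinOn ⟨m₀, le_refl (G m₀)⟩ hcompact
  -- Outside the sublevel set `G m' ≥ G m₀ ≥ G m`, so `m` minimizes over all of `L2Valued Ω N`.
  have hmin' : ∀ m', G m ≤ G m' := fun m' =>
    (le_total (G m') (G m₀)).elim (fun h => hmin h) fun h => le_trans hm h
  refine ⟨m, ?_, fun m' _ => ?_⟩
  · change quadraticEnergy K m < ⊤
    have hF : interactionEnergy K ψ m ≠ ⊤ :=
      ne_top_of_le_ne_top hG₀ (le_self_add.trans hm)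
    refine lt_top_iff_ne_top.2 fun h => hF ?_
    simpa only [h, ENNReal.mul_top hΛ1, top_le_iff] using hquad m
  · simp only [Set.mem_ofPred_eq, totalEnergy_eq P hb]
    exact add_le_add_left (EReal.coe_ennreal_le_coe_ennreal_iff.2 (hmin' m')) _
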